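/- **Setting.** For $R\ge 0$ let $\mathcal L(R)$ be the set of probability distributions on $[0,\infty)$ with mean at most $R$. In the single-battlefield General Lotto game with favoritism $\text{GL-F}(p,R_A,R_B)$, $p\in\mathbb R$, players $A$ and $B$ simultaneously choose $F_A\in\mathcal L(R_A)$ and $F_B\in\mathcal L(R_B)$. Player $A$ gets $U_A=\mathbb P[x_A+p\ge x_B]$ for independent $x_A\sim F_A$, $x_B\sim F_B$, and player $B$ gets $U_B=1-U_A$. Let $\pi_A^*(p,R_A,R_B)$ be player $A$'s Nash equilibrium payoff. Let $c_A,c_B\in(0,1)$, $M_B\ge 0$, $p_A\in[0,M_A/c_A]$, and assume $R_A:=M_A-c_Ap_A>0$. For $p_B\in[0,M_B/c_B]$ put $R_B:=M_B-c_Bp_B$, $\mathbf p:=(p_A,p_B)$, and let player $B$'s payoff be $u_B(\mathbf p):=1-\pi_A^*(p_A-p_B,R_A,R_B)$. Define $$f_A:=R_A+\sqrt{R_A(R_A+2(p_A-p_B))},\quad f_B:=\sqrt{R_B},\quad g_B:=\sqrt{R_B+2(p_B-p_A)},$$ $$u_B^{1A}:=\frac{R_B}{2R_A}\Big(\frac{f_A}{p_A-p_B+f_A}\Big)^2,\qquad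 u_B^{2A}:=1-\frac{R_A}{2(R_B-(p_A-p_B))},$$ $$u_B^{1B}:=1-\frac{R_A}{2}\Big(\frac{f_B+g_B}{p_B-p_A+f_B(f_B+g_B)}\Big)^2,\qquad u_B^{2B}:=\frac{R_B}{2(R_A-(p_B-p_A))}.$$ **Lemma.** For fixed $(p_A,R_A)$ as above, the Nash equilibrium payoff of $\text{GL-F}(p_A-p_B,R_A,R_B)$ exists and is unique for every $p_B\in[0,M_B/c_B]$, and: a) If $\frac{M_B}{c_B}\le R_A+p_A$, then $u_B(\mathbf p)$ is decreasing (i.e. nonincreasing) in $p_B\in[0,\frac{M_B}{c_B}]$, and strictly decreasing if $\frac{M_B}{c_B}<R_A+p_A$. b) If $R_A+p_A<\frac{M_B}{c_B}\le\frac{R_A}{c_B}+p_A$, then $$u_B(\mathbf p)=\begin{cases}u_B^{1A}(\mathbf p),&p_B\in[0,p_A]\\u_B^{2B}(\mathbf p),&p_B\in(p_A,p_B^{1B}]\\u_B^{1B}(\mathbf p),&p_B\in(p_B^{1B},\frac{M_B}{c_B}]\end{cases}$$ where $p_B^{1B}$ is the unique solution in $[p_A,R_A+p_A)$ of $F(p_B):=\frac{2(R_A+p_A-p_B)^2}{2R_A+p_A-p_B}=M_B-c_Bp_B$.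 c) If $\frac{R_A}{c_B}+p_A<\frac{M_B}{c_B}\le\frac1{c_B}\Big(p_A+\frac{R_A+\sqrt{R_A(R_A+2p_A)}}2\Big)$, then $$u_B(\mathbf p)=\begin{cases}u_B^{1A}(\mathbf p),&p_B\in[0,p_B^{1A}]\\u_B^{2A}(\mathbf p),&p_B\in(p_B^{1A},p_A]\\u_B^{1B}(\mathbf p),&p_B\in(p_A,\frac{M_B}{c_B}]\end{cases}$$ where $p_B^{1A}$ is the unique solution of $G(p_B):=\frac{2(M_B+(1-c_B)p_B-p_A)^2}{2(M_B-c_Bp_B)-(p_A-p_B)}=R_A$ among the $p_B\in[0,p_A)$ with $M_B-c_Bp_B\ge p_A-p_B$. d) If $\frac{M_B}{c_B}>\frac1{c_B}\Big(p_A+\frac{R_A+\sqrt{R_A(R_A+2p_A)}}2\Big)$, then $$u_B(\mathbf p)=\begin{cases}u_B^{2A}(\mathbf p),&p_B\in[0,p_A]\\u_B^{1B}(\mathbf p),&p_B\in(p_A,\frac{M_B}{c_B}].\end{cases}$$ -/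

import Mathlib

open MeasureTheory Set
open scoped NNReal ENNReal

/-- Admissible (randomized) strategies on a single battlefield for a player with real-time
budget `R`: probability laws on `[0, ∞)` whose expected expenditure is at most `R`. -/
def LottoStrategies (R : ℝ) : Set (ProbabilityMeasure ℝ≥0) :=
  {F | ∫⁻ x, (x : ℝ≥0∞) ∂(F : Measure ℝ≥0) ≤ ENNReal.ofReal R}

/-- Expected payoff of player `A` on a battlefield of unit value, `p` being the (signed)
favoritism towards `A`: the probability that `x_A + p ≥ x_B`, for independent
`x_A ∼ F_A` and `x_B ∼ F_B`. -/
noncomputable def lottoPayoffA (p : ℝ) (FA FB : ProbabilityMeasure ℝ≥0) : ℝ :=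
  ((FA : Measure ℝ≥0).prod (FB : Measure ℝ≥0)).real
    {z : ℝ≥0 × ℝ≥0 | (z.1 : ℝ) + p ≥ (z.2 : ℝ)}

/-- Expected payoff of player `B`. -/
noncomputable def lottoPayoffB (p : ℝ) (FA FB : ProbabilityMeasure ℝ≥0) : ℝ :=
  1 - lottoPayoffA p FA FB

/-- Nash equilibria of the General Lotto game with favoritism `GL-F(p, R_A, R_B)`. -/
def IsLottoNash (p RA RB : ℝ) (FA FB : ProbabilityMeasure ℝ≥0) : Prop :=
  FA ∈ LottoStrategies RA ∧ FB ∈ LottoStrategies RB ∧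
    (∀ FA' ∈ LottoStrategies RA, lottoPayoffA p FA' FB ≤ lottoPayoffA p FA FB) ∧
    (∀ FB' ∈ LottoStrategies RB, lottoPayoffB p FA FB' ≤ lottoPayoffB p FA FB)

/-- The payoffs that player `A` obtains in the Nash equilibria of `GL-F(p, R_A, R_B)`. -/
def lottoNashPayoffsA (p RA RB : ℝ) : Set ℝ :=
  {v | ∃ FA FB : ProbabilityMeasure ℝ≥0, IsLottoNash p RA RB FA FB ∧ lottoPayoffA p FA FB = v}

/-- The equilibrium payoff `π_A^*(p, R_A, R_B)`: the element of `lottoNashPayoffsA p RA RB`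
whenever this set is a singleton. -/
noncomputable def lottoEqPayoffA (p RA RB : ℝ) : ℝ :=
  sSup (lottoNashPayoffsA p RA RB)

/-- Player `A`'s payoff `u_A(p_A, p_B)` in the Stackelberg game with monetary budgets
`MA, MB` and per-unit costs `cA, cB`. -/
noncomputable def stackPayoffA (MA cA MB cB pA pB : ℝ) : ℝ :=
  lottoEqPayoffA (pA - pB) (MA - cA * pA) (MB - cB * pB)

/-- Player `B`'s payoff `u_B(p_A, p_B)` in the Stackelberg game. -/
noncomputable def stackPayoffB (MA cA MB cB pA pB : ℝ) : ℝ :=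
  1 - stackPayoffA MA cA MB cB pA pB

/-- `f_A(p) = R_A + √(R_A (R_A + 2 (p_A - p_B)))`. -/
noncomputable def fA (RA pA pB : ℝ) : ℝ :=
  RA + √(RA * (RA + 2 * (pA - pB)))

/-- `f_B(p) = √R_B`, where `R_B = M_B - c_B p_B`. -/
noncomputable def fB (MB cB pB : ℝ) : ℝ :=
  √(MB - cB * pB)

/-- `g_B(p) = √(R_B + 2 (p_B - p_A))`, where `R_B = M_B - c_B p_B`. -/
noncomputable def gB (MB cB pA pB : ℝ) : ℝ :=
  √(MB - cB * pB + 2 * (pB - pA))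

/-- The formula `u_B^{1A}`. -/
noncomputable def uB1A (RA MB cB pA pB : ℝ) : ℝ :=
  (MB - cB * pB) / (2 * RA) * (fA RA pA pB / (pA - pB + fA RA pA pB)) ^ 2

/-- The formula `u_B^{2A}`. -/
noncomputable def uB2A (RA MB cB pA pB : ℝ) : ℝ :=
  1 - RA / (2 * (MB - cB * pB - (pA - pB)))

/-- The formula `u_B^{1B}`. -/
noncomputable def uB1B (RA MB cB pA pB : ℝ) : ℝ :=
  1 - RA / 2 * ((fB MB cB pB + gB MB cB pA pB) /
    (pB - pA + fB MB cB pB * (fB MB cB pB + gB MB cB pA pB))) ^ 2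

/-- The formula `u_B^{2B}`. -/
noncomputable def uB2B (RA MB cB pA pB : ℝ) : ℝ :=
  (MB - cB * pB) / (2 * (RA - (pB - pA)))

/-- The function `F` of `p_B`; the breakpoint `p_B^{1B}` solves `F(p_B) = M_B - c_B p_B`. -/
noncomputable def breakF (RA pA pB : ℝ) : ℝ :=
  2 * (RA + pA - pB) ^ 2 / (2 * RA + pA - pB)

/-- The function `G` of `p_B`; the breakpoint `p_B^{1A}` solves `G(p_B) = R_A`. -/
noncomputable def breakG (MB cB pA pB : ℝ) : ℝ :=
  2 * (MB + (1 - cB) * pB - pA) ^ 2 / (2 * (MB - cB * pB) - (pA - pB))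

/-- `q` is the unique element of the set `S` that satisfies `P`. -/
def IsUniqueSolOn (S : Set ℝ) (P : ℝ → Prop) (q : ℝ) : Prop :=
  q ∈ S ∧ P q ∧ ∀ q' ∈ S, P q' → q' = q

/-!
Let one player have the head start `p ≥ 0` and budget `R`, and the other, the chaser, budget `S`.
If the former plays a density `l` on `[0, k]` and the remaining mass at `0`, where `l (k + p) ≤ 1`,
then an expenditure `y` of the chaser loses with probability at least `l (k + p - y)`. If the chaser
plays the mass `β = S / (p + k / 2)` uniformly on `[p, p + k]` and the remaining mass at `0`, then
this beats an expenditure `x` with probability at least `β (1 - x / k)`. Both bounds are affine in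
the opponent's expenditure, hence integrate to guarantees that depend only on budgets; for
`k = max (R + √(R (R + 2 p))) (2 (S - p))` and a suitable `l` the two guarantees add up to `1`, so
they determine the value. The two branches of the maximum, with either player in the role of the
chaser, give the four payoff formulas, and the breakpoints are where the branches meet.

For the monotonicity of `u_B`, the payoff at `p_B ≤ p_A` is a quadratic polynomial in
`2 R_A / f_A`. For `p_B ≥ p_A` player `A` is the chaser, and when `B` moves budget into the head
start, a uniform strategy on an interval of suitable length still secures `A` the old value.
-/

/-- The number `v` is the value of `GL-F(p, R_A, R_B)`: each player has a strategy securing it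
against all strategies of the opponent. -/
def HasLottoValue (p RA RB v : ℝ) : Prop :=
  ∃ FA ∈ LottoStrategies RA, ∃ FB ∈ LottoStrategies RB,
    (∀ FB' ∈ LottoStrategies RB, v ≤ lottoPayoffA p FA FB') ∧
    (∀ FA' ∈ LottoStrategies RA, lottoPayoffA p FA' FB ≤ v)

namespace HasLottoValue

variable {p RA RB v : ℝ}

theorem nashPayoffsA_eq (h : HasLottoValue p RA RB v) : lottoNashPayoffsA p RA RB = {v} := by
  obtain ⟨FA, hFA, FB, hFB, hA, hB⟩ := h
  refine Subset.antisymm ?_ (singleton_subset_iff.2 ?_)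
  · rintro _ ⟨GA, GB, ⟨hGA, hGB, hGA_best, hGB_best⟩, rfl⟩
    exact le_antisymm ((sub_le_sub_iff_left 1).1 (hGB_best FB hFB) |>.trans (hB GA hGA))
      ((hA GB hGB).trans (hGA_best FA hFA))
  · have hv : lottoPayoffA p FA FB = v := le_antisymm (hB FA hFA) (hA FB hFB)
    exact ⟨FA, FB, ⟨hFA, hFB, fun GA hGA => hv ▸ hB GA hGA,
      fun GB hGB => sub_le_sub_left (hv ▸ hA GB hGB) 1⟩, hv⟩

theorem eqPayoffA_eq (h : HasLottoValue p RA RB v) : lottoEqPayoffA p RA RB = v := by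
  rw [lottoEqPayoffA, h.nashPayoffsA_eq, csSup_singleton]

theorem le_of_forall_le {w : ℝ} (h : HasLottoValue p RA RB v) {FA : ProbabilityMeasure ℝ≥0}
    (hFA : FA ∈ LottoStrategies RA) (hw : ∀ FB ∈ LottoStrategies RB, w ≤ lottoPayoffA p FA FB) :
    w ≤ v := by
  obtain ⟨-, -, FB, hFB, -, hB⟩ := h
  exact (hw FB hFB).trans (hB FA hFA)

end HasLottoValue

section Expectation

variable {R : ℝ} {F : ProbabilityMeasure ℝ≥0}

theorem integrable_coe_of_mem_lottoStrategies (hF : F ∈ LottoStrategies R) :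
    Integrable (fun x : ℝ≥0 => (x : ℝ)) (F : Measure ℝ≥0) := by
  refine ⟨by fun_prop, ?_⟩
  rw [hasFiniteIntegral_iff_ofReal (.of_forall fun x => x.2)]
  simpa only [ENNReal.ofReal_coe_nnreal] using hF.trans_lt ENNReal.ofReal_lt_top

theorem integral_coe_le_of_mem_lottoStrategies (hR : 0 ≤ R) (hF : F ∈ LottoStrategies R) :
    ∫ x : ℝ≥0, (x : ℝ) ∂(F : Measure ℝ≥0) ≤ R := by
  rw [integral_eq_lintegral_of_nonneg_ae (.of_forall fun x => x.2) (by fun_prop)]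
  simpa only [ENNReal.ofReal_coe_nnreal] using ENNReal.toReal_le_of_le_ofReal hR hF

theorem ae_eq_zero_of_mem_lottoStrategies_zero (hF : F ∈ LottoStrategies 0) :
    ∀ᵐ x ∂(F : Measure ℝ≥0), x = 0 := by
  have hzero : ∫⁻ x, (x : ℝ≥0∞) ∂(F : Measure ℝ≥0) = 0 :=
    nonpos_iff_eq_zero.1 (hF.trans_eq ENNReal.ofReal_zero)
  rw [lintegral_eq_zero_iff (by fun_prop)] at hzero
  filter_upwards [hzero] with x hx using by simpa using hx

end Expectation

section Payoff

variable (p : ℝ) (FA FB : ProbabilityMeasure ℝ≥0)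

theorem measurableSet_lottoWin :
    MeasurableSet {z : ℝ≥0 × ℝ≥0 | (z.1 : ℝ) + p ≥ (z.2 : ℝ)} :=
  measurableSet_le (by fun_prop) (by fun_prop)

theorem integrable_real_le_add :
    Integrable (fun x : ℝ≥0 => (FB : Measure ℝ≥0).real {y | (y : ℝ) ≤ x + p}) FA :=
  Measure.integrable_measure_prodMk_left (measurableSet_lottoWin p) (measure_ne_top _ _)

theorem integrable_real_sub_le :
    Integrable (fun y : ℝ≥0 => (FA : Measure ℝ≥0).real {x | (y : ℝ) - p ≤ x}) FB := by
  simpa [sub_le_iff_le_add] using Measure.integrable_measure_prodMk_left (μ := (FB : Measure ℝ≥0))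
    (ν := (FA : Measure ℝ≥0)) (measurable_swap (measurableSet_lottoWin p)) (measure_ne_top _ _)

theorem lottoPayoffA_eq_integral_left : lottoPayoffA p FA FB =
    ∫ x : ℝ≥0, (FB : Measure ℝ≥0).real {y | (y : ℝ) ≤ x + p} ∂(FA : Measure ℝ≥0) := by
  have hwin := measurableSet_lottoWin p
  rw [lottoPayoffA, measureReal_def, Measure.prod_apply hwin]
  exact (integral_toReal (measurable_measure_prodMk_left hwin).aemeasurable
    (.of_forall fun x => measure_lt_top _ _)).symm

theorem lottoPayoffA_eq_integral_right : lottoPayoffA p FA FB =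
    ∫ y : ℝ≥0, (FA : Measure ℝ≥0).real {x | (y : ℝ) - p ≤ x} ∂(FB : Measure ℝ≥0) := by
  have hwin := measurableSet_lottoWin p
  rw [lottoPayoffA, measureReal_def, Measure.prod_apply_symm hwin]
  simp only [sub_le_iff_le_add]
  exact (integral_toReal (measurable_measure_prodMk_right hwin).aemeasurable
    (.of_forall fun y => measure_lt_top _ _)).symm

variable {p FA FB} {R c l : ℝ}

theorem lottoPayoffA_le_of_real_le_affine (hR : 0 ≤ R) (hl : 0 ≤ l)
    (hFA : FA ∈ LottoStrategies R)
    (h : ∀ x : ℝ≥0, (FB : Measure ℝ≥0).real {y | (y : ℝ) ≤ x + p} ≤ c + l * x) :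
    lottoPayoffA p FA FB ≤ c + l * R := by
  have hint := (integrable_coe_of_mem_lottoStrategies hFA).const_mul l
  calc lottoPayoffA p FA FB
      = ∫ x : ℝ≥0, (FB : Measure ℝ≥0).real {y | (y : ℝ) ≤ x + p} ∂(FA : Measure ℝ≥0) :=
        lottoPayoffA_eq_integral_left p FA FB
    _ ≤ ∫ x : ℝ≥0, (c + l * x) ∂(FA : Measure ℝ≥0) :=
        integral_mono (integrable_real_le_add p FA FB) ((integrable_const c).add hint) h
    _ = c + l * ∫ x : ℝ≥0, (x : ℝ) ∂(FA : Measure ℝ≥0) := by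
        rw [integral_add (integrable_const c) hint, integral_const_mul]
        simp
    _ ≤ c + l * R := by
        gcongr
        exact integral_coe_le_of_mem_lottoStrategies hR hFA

theorem le_lottoPayoffA_of_affine_le_real (hR : 0 ≤ R) (hl : 0 ≤ l)
    (hFB : FB ∈ LottoStrategies R)
    (h : ∀ᵐ y : ℝ≥0 ∂(FB : Measure ℝ≥0),
      c - l * y ≤ (FA : Measure ℝ≥0).real {x | (y : ℝ) - p ≤ x}) :
    c - l * R ≤ lottoPayoffA p FA FB := by
  have hint := (integrable_coe_of_mem_lottoStrategies hFB).const_mul l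
  calc c - l * R ≤ c - l * ∫ y : ℝ≥0, (y : ℝ) ∂(FB : Measure ℝ≥0) := by
        gcongr
        exact integral_coe_le_of_mem_lottoStrategies hR hFB
    _ = ∫ y : ℝ≥0, (c - l * y) ∂(FB : Measure ℝ≥0) := by
        rw [integral_sub (integrable_const c) hint, integral_const_mul]
        simp
    _ ≤ ∫ y : ℝ≥0, (FA : Measure ℝ≥0).real {x | (y : ℝ) - p ≤ x} ∂(FB : Measure ℝ≥0) :=
        integral_mono_ae ((integrable_const c).sub hint) (integrable_real_sub_le p FA FB) h
    _ = lottoPayoffA p FA FB := (lottoPayoffA_eq_integral_right p FA FB).symm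

end Payoff

section Mix

variable {b a k z : ℝ}

theorem measurable_toNNReal_add_mul (a k : ℝ) : Measurable fun u : ℝ => (a + k * u).toNNReal := by
  fun_prop

/-- The probability law with an atom of weight `1 - b` at `0` that spreads the remaining
weight `b` uniformly over `[a, a + k]`, encoded as the image of the uniform law on `[0, 1]` under
`u ↦ a + k * u`. All optimal strategies have this form. -/
noncomputable def lottoMix (b a k : ℝ) (hb : b ∈ Icc (0 : ℝ) 1) : ProbabilityMeasure ℝ≥0 :=
  ⟨(1 - b).toNNReal • Measure.dirac 0 +
    b.toNNReal • (volume.restrict (Icc (0 : ℝ) 1)).map fun u => (a + k * u).toNNReal, by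
    constructor
    simp [Measure.map_apply (measurable_toNNReal_add_mul a k) MeasurableSet.univ,
      ← ENNReal.coe_add, ← Real.toNNReal_add (sub_nonneg.2 hb.2) hb.1]⟩

theorem lottoMix_coe (hb : b ∈ Icc (0 : ℝ) 1) : (lottoMix b a k hb : Measure ℝ≥0) =
    (1 - b).toNNReal • Measure.dirac 0 +
      b.toNNReal • (volume.restrict (Icc (0 : ℝ) 1)).map fun u => (a + k * u).toNNReal :=
  rfl

theorem setLIntegral_Icc_ofReal_add_mul (ha : 0 ≤ a) (hk : 0 ≤ k) :
    ∫⁻ u in Icc (0 : ℝ) 1, ENNReal.ofReal (a + k * u) = ENNReal.ofReal (a + k / 2) := by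
  have hcont : Continuous fun u : ℝ => a + k * u := by fun_prop
  have hint : ∫ u in (0 : ℝ)..1, (a + k * u) = a + k / 2 := by
    rw [intervalIntegral.integral_add (by simp) (Continuous.intervalIntegrable (by fun_prop) _ _),
      intervalIntegral.integral_const_mul, intervalIntegral.integral_const, integral_id,
      smul_eq_mul]
    ring
  rw [← ofReal_integral_eq_lintegral_ofReal hcont.integrableOn_Icc,
    integral_Icc_eq_integral_Ioc, ← intervalIntegral.integral_of_le zero_le_one, hint]
  filter_upwards [ae_restrict_mem measurableSet_Icc] with u hu
  exact add_nonneg ha (mul_nonneg hk hu.1)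

theorem lottoMix_mem_lottoStrategies {R : ℝ} (hb : b ∈ Icc (0 : ℝ) 1) (ha : 0 ≤ a) (hk : 0 ≤ k)
    (hR : b * (a + k / 2) ≤ R) : lottoMix b a k hb ∈ LottoStrategies R := by
  have hmean : ∫⁻ x, (x : ℝ≥0∞) ∂(lottoMix b a k hb : Measure ℝ≥0) =
      ENNReal.ofReal (b * (a + k / 2)) := by
    rw [lottoMix_coe, lintegral_add_measure, lintegral_smul_measure, lintegral_smul_measure,
      lintegral_dirac, lintegral_map (by fun_prop) (measurable_toNNReal_add_mul a k),
      ENNReal.ofReal_mul hb.1, ← setLIntegral_Icc_ofReal_add_mul ha hk]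
    simp [ENNReal.ofReal, ENNReal.smul_def]
  exact hmean.trans_le (ENNReal.ofReal_le_ofReal hR)

theorem lottoMix_real_apply (hb : b ∈ Icc (0 : ℝ) 1) {s : Set ℝ≥0} (hs : MeasurableSet s) :
    (lottoMix b a k hb : Measure ℝ≥0).real s =
      (1 - b) * s.indicator 1 0 +
        b * volume.real ((fun u : ℝ => (a + k * u).toNNReal) ⁻¹' s ∩ Icc 0 1) := by
  have hmap := measurable_toNNReal_add_mul a k
  rw [lottoMix_coe, measureReal_add_apply, measureReal_nnreal_smul_apply,
    measureReal_nnreal_smul_apply, map_measureReal_apply hmap hs,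
    measureReal_restrict_apply (hmap hs), Real.coe_toNNReal _ (sub_nonneg.2 hb.2),
    Real.coe_toNNReal _ hb.1, measureReal_def, Measure.dirac_apply' _ hs]
  by_cases h : (0 : ℝ≥0) ∈ s <;> simp [h]

theorem mul_volume_le_lottoMix_real (hb : b ∈ Icc (0 : ℝ) 1) {s : Set ℝ≥0}
    (hs : MeasurableSet s) {t : Set ℝ}
    (ht : t ⊆ (fun u : ℝ => (a + k * u).toNNReal) ⁻¹' s ∩ Icc 0 1) :
    b * volume.real t ≤ (lottoMix b a k hb : Measure ℝ≥0).real s := by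
  rw [lottoMix_real_apply hb hs]
  have hatom : 0 ≤ (1 - b) * s.indicator 1 (0 : ℝ≥0) :=
    mul_nonneg (sub_nonneg.2 hb.2) (indicator_nonneg (by simp) _)
  have hmono := measureReal_mono (μ := volume) ht
    (measure_inter_lt_top_of_right_ne_top (by simp)).ne
  linarith [mul_le_mul_of_nonneg_left hmono hb.1]

theorem measurableSet_le_coe (z : ℝ) : MeasurableSet {y : ℝ≥0 | z ≤ (y : ℝ)} :=
  measurableSet_le (by fun_prop) (by fun_prop)

theorem le_lottoMix_real_Ici (hb : b ∈ Icc (0 : ℝ) 1) (hk : 0 < k) (hz : a ≤ z) :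
    b * (1 - (z - a) / k) ≤ (lottoMix b a k hb : Measure ℝ≥0).real {y | z ≤ (y : ℝ)} := by
  have hz' : 0 ≤ (z - a) / k := div_nonneg (sub_nonneg.2 hz) hk.le
  have hsub : Icc ((z - a) / k) 1 ⊆
      (fun u : ℝ => (a + k * u).toNNReal) ⁻¹' {y | z ≤ (y : ℝ)} ∩ Icc 0 1 := by
    rintro u ⟨hu, hu1⟩
    rw [div_le_iff₀ hk] at hu
    exact ⟨le_trans (by linarith) (Real.le_coe_toNNReal _), hz'.trans (by rwa [div_le_iff₀ hk]),
      hu1⟩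
  refine le_trans ?_ (mul_volume_le_lottoMix_real hb (measurableSet_le_coe z) hsub)
  rw [Real.volume_real_Icc]
  exact mul_le_mul_of_nonneg_left (le_max_left _ _) hb.1

theorem le_lottoMix_real_Ici_left (hb : b ∈ Icc (0 : ℝ) 1) (hk : 0 ≤ k) :
    b ≤ (lottoMix b a k hb : Measure ℝ≥0).real {y | a ≤ (y : ℝ)} := by
  have hsub : Icc (0 : ℝ) 1 ⊆
      (fun u : ℝ => (a + k * u).toNNReal) ⁻¹' {y | a ≤ (y : ℝ)} ∩ Icc 0 1 := fun u hu =>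
    ⟨le_trans (by linarith [mul_nonneg hk hu.1]) (Real.le_coe_toNNReal _), hu⟩
  simpa using mul_volume_le_lottoMix_real hb (measurableSet_le_coe a) hsub

theorem lottoMix_real_Iic_le (hb : b ∈ Icc (0 : ℝ) 1) (ha : 0 ≤ a) (hk : 0 < k) (hz : a ≤ z) :
    (lottoMix b a k hb : Measure ℝ≥0).real {y | (y : ℝ) ≤ z} ≤ 1 - b + b * ((z - a) / k) := by
  have hsub : (fun u : ℝ => (a + k * u).toNNReal) ⁻¹' {y | (y : ℝ) ≤ z} ∩ Icc 0 1 ⊆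
      Icc 0 ((z - a) / k) := by
    rintro u ⟨hu, hu0, -⟩
    refine ⟨hu0, (le_div_iff₀ hk).2 ?_⟩
    linarith [(Real.le_coe_toNNReal (a + k * u)).trans hu]
  have hvol := measureReal_mono (μ := volume) hsub (by simp)
  rw [Real.volume_real_Icc_of_le (div_nonneg (sub_nonneg.2 hz) hk.le), sub_zero] at hvol
  have hmem : (0 : ℝ≥0) ∈ {y : ℝ≥0 | (y : ℝ) ≤ z} := by simpa using ha.trans hz
  rw [lottoMix_real_apply hb (measurableSet_le (by fun_prop) (by fun_prop)),
    indicator_of_mem hmem, Pi.one_apply, mul_one]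
  gcongr
  exact hb.1

end Mix

section Guarantees

variable {q R k l β : ℝ} {F : ProbabilityMeasure ℝ≥0}

theorem le_lottoPayoffA_headStart (hR : 0 ≤ R) (hk : 0 < k) (hl : 0 ≤ l)
    (hlk : l * k ∈ Icc (0 : ℝ) 1) (hlkq : l * (k + q) ≤ 1) (hF : F ∈ LottoStrategies R) :
    l * (k + q) - l * R ≤ lottoPayoffA q (lottoMix (l * k) 0 k hlk) F := by
  refine le_lottoPayoffA_of_affine_le_real hR hl hF (.of_forall fun y => ?_)
  rcases le_or_gt ((y : ℝ) - q) 0 with hy | hy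
  · have huniv : {x : ℝ≥0 | (y : ℝ) - q ≤ x} = univ := eq_univ_of_forall fun x => hy.trans x.2
    rw [huniv, probReal_univ]
    linarith [mul_nonneg hl y.coe_nonneg]
  · refine le_trans (le_of_eq ?_) (le_lottoMix_real_Ici hlk hk hy.le)
    field_simp
    ring

theorem lottoPayoffA_chaser_le (hq : 0 ≤ q) (hR : 0 ≤ R) (hk : 0 < k) (hβ : β ∈ Icc (0 : ℝ) 1)
    (hF : F ∈ LottoStrategies R) :
    lottoPayoffA q F (lottoMix β q k hβ) ≤ 1 - β * (1 - R / k) := by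
  have hle := lottoPayoffA_le_of_real_le_affine (p := q) (c := 1 - β) (l := β / k)
    (FB := lottoMix β q k hβ) hR (div_nonneg hβ.1 hk.le) hF fun x =>
      (lottoMix_real_Iic_le hβ hq hk (le_add_of_nonneg_left x.coe_nonneg)).trans_eq (by ring)
  linarith [mul_div_right_comm β R k, mul_div_assoc β R k]

theorem lottoPayoffA_neg_headStart_le (hR : 0 ≤ R) (hk : 0 ≤ k) (hl : 0 ≤ l)
    (hlk : l * k ∈ Icc (0 : ℝ) 1) (hlkq : l * (k + q) ≤ 1) (hF : F ∈ LottoStrategies R) :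
    lottoPayoffA (-q) F (lottoMix (l * k) 0 k hlk) ≤ 1 - l * (k + q) + l * R := by
  refine lottoPayoffA_le_of_real_le_affine hR hl hF fun x => ?_
  rcases lt_or_ge ((x : ℝ) + -q) 0 with hx | hx
  · have hempty : {y : ℝ≥0 | (y : ℝ) ≤ x + -q} = ∅ :=
      eq_empty_of_forall_notMem fun y hy => hx.not_ge (y.2.trans hy)
    rw [hempty, measureReal_empty]
    linarith [mul_nonneg hl x.coe_nonneg]
  rcases hk.eq_or_lt with rfl | hk
  · exact measureReal_le_one.trans (by linarith [mul_nonneg hl hx])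
  · refine (lottoMix_real_Iic_le hlk le_rfl hk hx).trans_eq ?_
    field_simp
    ring

theorem le_lottoPayoffA_neg_chaser (hR : 0 ≤ R) (hk : 0 < k) (hβ : β ∈ Icc (0 : ℝ) 1)
    (hF : F ∈ LottoStrategies R) :
    β * (1 - R / k) ≤ lottoPayoffA (-q) (lottoMix β q k hβ) F := by
  refine le_trans (le_of_eq ?_) (le_lottoPayoffA_of_affine_le_real (c := β) hR
    (div_nonneg hβ.1 hk.le) hF (.of_forall fun y => ?_))
  · ring
  · rw [sub_neg_eq_add]
    refine le_trans (le_of_eq ?_) (le_lottoMix_real_Ici hβ hk (le_add_of_nonneg_left y.coe_nonneg))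
    ring

theorem le_lottoPayoffA_neg_chaser_zero (hβ : β ∈ Icc (0 : ℝ) 1) (hF : F ∈ LottoStrategies 0) :
    β ≤ lottoPayoffA (-q) (lottoMix β q 0 hβ) F := by
  refine le_trans (le_of_eq ?_) (le_lottoPayoffA_of_affine_le_real (c := β) le_rfl le_rfl hF ?_)
  · ring
  · filter_upwards [ae_eq_zero_of_mem_lottoStrategies_zero hF] with y hy
    simpa [hy] using le_lottoMix_real_Ici_left (a := q) hβ le_rfl

end Guarantees

section HeadRoot

/-- The positive root of `h ^ 2 = 2 * R * (h + p)`. With a head start `p`, a player of budget `R`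
can play the density `1 / (h + p)` on `[0, h]`; for `p = p_A - p_B` this is the paper's `f_A`. -/
noncomputable def headRoot (p R : ℝ) : ℝ :=
  R + √(R * (R + 2 * p))

variable {p R t : ℝ}

theorem headRoot_sq (hp : 0 ≤ p) (hR : 0 ≤ R) :
    headRoot p R ^ 2 = 2 * R * (headRoot p R + p) := by
  have hsq : √(R * (R + 2 * p)) ^ 2 = R * (R + 2 * p) := Real.sq_sqrt (by positivity)
  rw [headRoot]
  linear_combination hsq

theorem two_mul_le_headRoot (hp : 0 ≤ p) (hR : 0 ≤ R) : 2 * R ≤ headRoot p R := by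
  have hsqrt : R ≤ √(R * (R + 2 * p)) := Real.le_sqrt_of_sq_le (by nlinarith [mul_nonneg hR hp])
  rw [headRoot]
  linarith

theorem headRoot_pos (hp : 0 ≤ p) (hR : 0 < R) : 0 < headRoot p R :=
  lt_of_lt_of_le (by positivity) (two_mul_le_headRoot hp hR.le)

@[simp] theorem headRoot_zero_left (hR : 0 ≤ R) : headRoot 0 R = 2 * R := by
  rw [headRoot, mul_zero, add_zero, Real.sqrt_mul_self hR, two_mul]

@[simp] theorem headRoot_zero_right : headRoot p 0 = 0 := by
  simp [headRoot]

theorem headRoot_strictMonoOn_left (hR : 0 < R) :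
    StrictMonoOn (fun p => headRoot p R) (Ici 0) := fun p hp q _ hpq => by
  have hp : 0 ≤ p := hp
  exact add_lt_add_right (Real.sqrt_lt_sqrt (by positivity) (by gcongr)) R

theorem sq_sub_eq_mul_headRoot (hp : 0 ≤ p) (hR : 0 ≤ R) (t : ℝ) :
    t ^ 2 - 2 * R * (t + p) = (t - headRoot p R) * (t + (headRoot p R - 2 * R)) := by
  linear_combination headRoot_sq hp hR

theorem headRoot_le_iff (hp : 0 ≤ p) (hR : 0 ≤ R) (ht : 0 < t) :
    headRoot p R ≤ t ↔ 2 * R * (t + p) ≤ t ^ 2 := by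
  have hfactor : 0 < t + (headRoot p R - 2 * R) := by linarith [two_mul_le_headRoot hp hR]
  rw [← sub_nonneg, ← sub_nonneg (a := t ^ 2), sq_sub_eq_mul_headRoot hp hR,
    mul_nonneg_iff_of_pos_right hfactor]

theorem le_headRoot_iff (hp : 0 ≤ p) (hR : 0 ≤ R) (ht : 0 < t) :
    t ≤ headRoot p R ↔ t ^ 2 ≤ 2 * R * (t + p) := by
  have hfactor : 0 < t + (headRoot p R - 2 * R) := by linarith [two_mul_le_headRoot hp hR]
  rw [← sub_nonneg, ← sub_nonneg (b := t ^ 2), ← neg_sub t, ← neg_sub (t ^ 2),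
    sq_sub_eq_mul_headRoot hp hR, ← neg_mul, mul_nonneg_iff_of_pos_right hfactor]

end HeadRoot

section Value

/-- The length of the interval over which both players spread their expenditure at equilibrium,
when the player with the head start `p ≥ 0` has budget `R` and the other one has budget `S`. -/
noncomputable def lottoWidth (p R S : ℝ) : ℝ :=
  max (headRoot p R) (2 * (S - p))

/-- The equilibrium payoff of the player with budget `S` against an opponent who has the head start
`p ≥ 0` and budget `R`. For `R = 0` and `S ≤ p` the width is `0`, and `R / 0 = 0` gives the correct
value `S / p`. -/
noncomputable def chaserValue (p R S : ℝ) : ℝ :=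
  S / (p + lottoWidth p R S / 2) * (1 - R / lottoWidth p R S)

variable {p R S k : ℝ}

theorem lottoWidth_pos (hp : 0 ≤ p) (hR : 0 < R) : 0 < lottoWidth p R S :=
  lt_max_of_lt_left (headRoot_pos hp hR)

theorem lottoWidth_nonneg (hp : 0 ≤ p) (hR : 0 ≤ R) : 0 ≤ lottoWidth p R S :=
  le_max_of_le_left (by linarith [two_mul_le_headRoot hp hR])

theorem two_mul_le_lottoWidth (hp : 0 ≤ p) (hR : 0 ≤ R) : 2 * R ≤ lottoWidth p R S :=
  (two_mul_le_headRoot hp hR).trans (le_max_left _ _)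

theorem le_add_lottoWidth_div_two : S ≤ p + lottoWidth p R S / 2 := by
  have := le_max_right (headRoot p R) (2 * (S - p))
  rw [lottoWidth]
  linarith

theorem chaserValue_of_le (hp : 0 ≤ p) (hR : 0 ≤ R) (hpos : 0 < p + headRoot p R)
    (hS : S ≤ p + headRoot p R / 2) : chaserValue p R S = S / (p + headRoot p R) := by
  have hroot := two_mul_le_headRoot hp hR
  have hsq := headRoot_sq hp hR
  rw [chaserValue, lottoWidth, max_eq_left (by linarith)]
  set h := headRoot p R
  rcases (show 0 ≤ h by linarith).eq_or_lt with h0 | h0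
  · simp [← h0]
  · have hpos' : 0 < p + h / 2 := by linarith
    rw [div_mul_eq_mul_div, div_eq_div_iff hpos'.ne' hpos.ne']
    field_simp
    linear_combination S * hsq

theorem chaserValue_of_ge (hS0 : 0 < S) (hS : p + headRoot p R / 2 ≤ S) :
    chaserValue p R S = 1 - R / (2 * (S - p)) := by
  rw [chaserValue, lottoWidth, max_eq_right (by linarith), mul_div_cancel_left₀ _ two_ne_zero,
    add_sub_cancel, div_self hS0.ne', one_mul]

theorem exists_headStart_density (hp : 0 ≤ p) (hR : 0 ≤ R) (hpos : 0 < p + lottoWidth p R S) :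
    ∃ l, 0 ≤ l ∧ l * lottoWidth p R S ^ 2 / 2 ≤ R ∧ l * (lottoWidth p R S + p) ≤ 1 ∧
      l * (lottoWidth p R S + p) - l * S = 1 - chaserValue p R S := by
  have hroot := two_mul_le_headRoot hp hR
  rcases le_or_gt (2 * (S - p)) (headRoot p R) with hle | hlt
  · rw [lottoWidth, max_eq_left hle] at hpos ⊢
    have hsq := headRoot_sq hp hR
    rw [chaserValue_of_le hp hR hpos (by linarith)]
    rw [add_comm] at hpos
    refine ⟨1 / (headRoot p R + p), by positivity, le_of_eq ?_, le_of_eq ?_, ?_⟩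
    · rw [hsq]
      field_simp
    · field_simp
    · rw [add_comm p]
      field_simp
  · have hw : 0 < 2 * (S - p) := by linarith
    have hSp : 0 < S - p := by linarith
    rw [lottoWidth, max_eq_right hlt.le, chaserValue_of_ge (by linarith) (by linarith)]
    refine ⟨2 * R / (2 * (S - p)) ^ 2, by positivity, le_of_eq ?_, ?_, ?_⟩
    · field_simp
    · rw [div_mul_eq_mul_div, div_le_one (by positivity)]
      exact (headRoot_le_iff hp hR hw).1 hlt.le
    · field_simp
      ring

theorem chaserWeight_mem_Icc (hS : 0 ≤ S) (hk : S ≤ p + k / 2) :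
    S / (p + k / 2) ∈ Icc (0 : ℝ) 1 :=
  ⟨div_nonneg hS (hS.trans hk), div_le_one_of_le₀ hk (hS.trans hk)⟩

theorem lottoMix_chaser_mem_lottoStrategies (hp : 0 ≤ p) (hk0 : 0 ≤ k) (hpos : 0 < p + k / 2)
    (hβ : S / (p + k / 2) ∈ Icc (0 : ℝ) 1) :
    lottoMix (S / (p + k / 2)) p k hβ ∈ LottoStrategies S :=
  lottoMix_mem_lottoStrategies hβ hp hk0 (div_mul_cancel₀ S hpos.ne').le

theorem hasLottoValue_headStart (hp : 0 ≤ p) (hR : 0 < R) (hS : 0 ≤ S) :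
    HasLottoValue p R S (1 - chaserValue p R S) := by
  have hk := lottoWidth_pos (S := S) hp hR
  obtain ⟨l, hl, hbudget, hcap, hval⟩ := exists_headStart_density (S := S) hp hR.le (by linarith)
  have hlk : l * lottoWidth p R S ∈ Icc (0 : ℝ) 1 :=
    ⟨mul_nonneg hl hk.le, by nlinarith [mul_nonneg hl hp]⟩
  have hβ := chaserWeight_mem_Icc hS (le_add_lottoWidth_div_two (p := p) (R := R))
  refine ⟨lottoMix _ 0 _ hlk, lottoMix_mem_lottoStrategies hlk le_rfl hk.le (by linarith),
    lottoMix _ p _ hβ, lottoMix_chaser_mem_lottoStrategies hp hk.le (by linarith) hβ,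
    fun FB hFB => ?_, fun FA hFA => lottoPayoffA_chaser_le hp hR.le hk hβ hFA⟩
  exact hval ▸ le_lottoPayoffA_headStart hS hk hl hlk hcap hFB

theorem hasLottoValue_neg_headStart (hp : 0 ≤ p) (hR : 0 ≤ R) (hS : 0 < S) :
    HasLottoValue (-p) S R (chaserValue p R S) := by
  have hk := lottoWidth_nonneg (S := S) hp hR
  have hpos : 0 < p + lottoWidth p R S / 2 := hS.trans_le le_add_lottoWidth_div_two
  obtain ⟨l, hl, hbudget, hcap, hval⟩ := exists_headStart_density (S := S) hp hR (by linarith)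
  have hlk : l * lottoWidth p R S ∈ Icc (0 : ℝ) 1 :=
    ⟨mul_nonneg hl hk, by nlinarith [mul_nonneg hl hp]⟩
  have hβ := chaserWeight_mem_Icc hS.le (le_add_lottoWidth_div_two (p := p) (R := R))
  refine ⟨lottoMix _ p _ hβ, lottoMix_chaser_mem_lottoStrategies hp hk hpos hβ, lottoMix _ 0 _ hlk,
    lottoMix_mem_lottoStrategies hlk le_rfl hk (by linarith), fun FB hFB => ?_, fun FA hFA => ?_⟩
  · rw [chaserValue]
    rcases hk.eq_or_lt with hk0 | hk0
    · obtain rfl : R = 0 := by linarith [two_mul_le_lottoWidth (S := S) hp hR]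
      revert hβ
      simp only [← hk0, zero_div, sub_zero, mul_one]
      exact fun hβ => le_lottoPayoffA_neg_chaser_zero hβ hFB
    · exact le_lottoPayoffA_neg_chaser hR hk0 hβ hFB
  · linarith [lottoPayoffA_neg_headStart_le hS.le hk hl hlk hcap hFA]

theorem le_chaserValue (hp : 0 ≤ p) (hR : 0 ≤ R) (hS : 0 < S) (hk : 0 < k)
    (hSk : S ≤ p + k / 2) : S / (p + k / 2) * (1 - R / k) ≤ chaserValue p R S :=
  have hβ := chaserWeight_mem_Icc hS.le hSk
  (hasLottoValue_neg_headStart hp hR hS).le_of_forall_le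
    (lottoMix_chaser_mem_lottoStrategies hp hk.le (by linarith) hβ) fun _ hF =>
      le_lottoPayoffA_neg_chaser hR hk hβ hF

theorem exists_hasLottoValue (p : ℝ) {RA RB : ℝ} (hRA : 0 < RA) (hRB : 0 ≤ RB) :
    ∃ v, HasLottoValue p RA RB v := by
  rcases le_total 0 p with hp | hp
  · exact ⟨_, hasLottoValue_headStart hp hRA hRB⟩
  · exact ⟨_, neg_neg p ▸ hasLottoValue_neg_headStart (neg_nonneg.2 hp) hRB hRA⟩

end Value

section Monotonicity

variable {p R S c d e : ℝ}

-- The chaser's uniform interval that is optimal against `R'` is still available against `R`.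
theorem chaserValue_strictAntiOn_budget (hp : 0 ≤ p) (hS : 0 < S) :
    StrictAntiOn (fun R => chaserValue p R S) (Ici 0) := fun R hR R' _ hlt => by
  have hR : 0 ≤ R := hR
  have hk := lottoWidth_pos (S := S) hp (hR.trans_lt hlt)
  have hSk : S ≤ p + lottoWidth p R' S / 2 := le_add_lottoWidth_div_two
  calc chaserValue p R' S
      < S / (p + lottoWidth p R' S / 2) * (1 - R / lottoWidth p R' S) := by
        rw [chaserValue]
        gcongr
    _ ≤ chaserValue p R S := le_chaserValue hp hR hS hk hSk

theorem chaserValue_eq_quadratic (hp : 0 ≤ p) (hR : 0 < R)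
    (hS : e + c * p ≤ p + headRoot p R / 2) :
    chaserValue p R (e + c * p) =
      c * (1 - 2 * R / headRoot p R) + e / (2 * R) * (2 * R / headRoot p R) ^ 2 := by
  have hh := headRoot_pos hp hR
  have hsq := headRoot_sq hp hR.le
  rw [chaserValue_of_le hp hR.le (by linarith) hS]
  set h := headRoot p R
  have hph : p + h ≠ 0 := by linarith
  field_simp
  linear_combination (e - c * h) * hsq

theorem chaserValue_add_mul_strictMonoOn (hR : 0 < R) (hc0 : 0 < c) (hc1 : c ≤ 1)
    (he : e ≤ c * R) : StrictMonoOn (fun p => chaserValue p R (e + c * p)) (Ici 0) := by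
  intro p hp p' hp' hlt
  have hregion : ∀ x, 0 ≤ x → e + c * x ≤ x + headRoot x R / 2 := fun x hx => by
    nlinarith [two_mul_le_headRoot hx hR.le]
  have hroot := two_mul_le_headRoot hp hR.le
  have hroot_lt : headRoot p R < headRoot p' R := headRoot_strictMonoOn_left hR hp hp' hlt
  have hh := headRoot_pos hp hR
  simp only [chaserValue_eq_quadratic hp hR (hregion p hp),
    chaserValue_eq_quadratic hp' hR (hregion p' hp')]
  set z := 2 * R / headRoot p R
  set z' := 2 * R / headRoot p' R
  have hz : z ≤ 1 := div_le_one_of_le₀ hroot hh.le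
  have hz' : 0 < z' := by have := hh.trans hroot_lt; positivity
  have hzz' : z' < z := div_lt_div_of_pos_left (by positivity) hh hroot_lt
  have hcoeff : e / (2 * R) ≤ c / 2 := by
    rw [div_le_div_iff₀ (by positivity) two_pos]
    linarith
  have hslope : e / (2 * R) * (z + z') < c := by nlinarith
  nlinarith [mul_pos (sub_pos.2 hzz') (sub_pos.2 hslope)]

theorem chaserValue_zero_self (hS : 0 < S) : chaserValue S 0 S = 1 := by
  rw [chaserValue_of_le hS.le le_rfl (by simpa using hS) (by simp), headRoot_zero_right, add_zero,
    div_self hS.ne']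

theorem chaserValue_le_shift_of_le (hp : 0 ≤ p) (hS : 0 < S) (hc : 0 < c) (hd : 0 < d)
    (hR : R ≤ c * (S - p)) (hpos : 0 ≤ R - c * d) (hle : S ≤ p + headRoot p R / 2) :
    chaserValue p R S ≤ chaserValue (p + d) (R - c * d) S := by
  have hR0 : 0 < R := by nlinarith
  have hh := headRoot_pos hp hR0
  have hsq := headRoot_sq hp hR0.le
  rw [chaserValue_of_le hp hR0.le (by linarith) hle]
  set h := headRoot p R
  refine le_trans ?_ (le_chaserValue (by linarith) hpos hS hh (by linarith))
  have hph : 0 < p + h := by linarith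
  have hhc : h ≤ c * (p + h) := by
    have : R ≤ c * (h / 2) := hR.trans (by gcongr; linarith)
    nlinarith
  rw [div_mul_eq_mul_div, div_le_div_iff₀ hph (by linarith), mul_assoc]
  gcongr
  rw [one_sub_div hh.ne', div_mul_eq_mul_div, le_div_iff₀ hh]
  nlinarith

theorem chaserValue_le_shift_of_ge (hp : 0 ≤ p) (hS : 0 < S) (hc : 0 < c) (hd : 0 < d)
    (hR : R ≤ c * (S - p)) (hpos : 0 ≤ R - c * d) (hge : p + headRoot p R / 2 ≤ S) :
    chaserValue p R S ≤ chaserValue (p + d) (R - c * d) S := by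
  have hR0 : 0 < R := by nlinarith
  have hSp : 0 < S - p := by nlinarith
  rw [chaserValue_of_ge hS hge]
  rcases lt_or_ge (p + d) S with hlt | hge'
  · have hsecure := le_chaserValue (p := p + d) (k := 2 * (S - (p + d))) (by linarith) hpos hS
      (by linarith) (by linarith)
    rw [mul_div_cancel_left₀ _ two_ne_zero, add_sub_cancel, div_self hS.ne', one_mul] at hsecure
    refine le_trans (sub_le_sub_left ?_ 1) hsecure
    rw [div_le_div_iff₀ (by positivity) (by positivity)]
    nlinarith
  · have hpd : p + d = S := by nlinarith
    have hRcd : R - c * d = 0 := by nlinarith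
    rw [hpd, hRcd, chaserValue_zero_self hS]
    exact sub_le_self _ (by positivity)

theorem chaserValue_le_shift (hp : 0 ≤ p) (hS : 0 < S) (hc : 0 < c) (hd : 0 < d)
    (hR : R ≤ c * (S - p)) (hpos : 0 ≤ R - c * d) :
    chaserValue p R S ≤ chaserValue (p + d) (R - c * d) S :=
  (le_total S (p + headRoot p R / 2)).elim (chaserValue_le_shift_of_le hp hS hc hd hR hpos)
    (chaserValue_le_shift_of_ge hp hS hc hd hR hpos)

theorem chaserValue_lt_shift (hp : 0 ≤ p) (hS : 0 < S) (hc : 0 < c) (hd : 0 < d)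
    (hR : R < c * (S - p)) (hpos : 0 ≤ R - c * d) :
    chaserValue p R S < chaserValue (p + d) (R - c * d) S := by
  have hR0 : 0 < R := by nlinarith
  have hSp : 0 < S - p := by nlinarith
  have hrate : R / (S - p) < c := (div_lt_iff₀ hSp).2 hR
  have hspend : R - c * d < R - R / (S - p) * d := by gcongr
  calc chaserValue p R S ≤ chaserValue (p + d) (R - R / (S - p) * d) S :=
        chaserValue_le_shift hp hS (by positivity) hd (div_mul_cancel₀ R hSp.ne').ge (by linarith)
    _ < chaserValue (p + d) (R - c * d) S :=
        chaserValue_strictAntiOn_budget (by linarith) hS hpos (hpos.trans hspend.le) hspend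

end Monotonicity

section Response

/-- Player `B`'s payoff from pre-allocating `p_B` once player `A` has committed to the
pre-allocation `p_A` and the real-time budget `R_A`. This is `stackPayoffB` without the parameters
`M_A` and `c_A`, on which it depends only through `R_A`. -/
noncomputable def responsePayoffB (RA MB cB pA pB : ℝ) : ℝ :=
  1 - lottoEqPayoffA (pA - pB) RA (MB - cB * pB)

variable {RA MB cB pA pB : ℝ}

theorem responsePayoffB_of_le (hRA : 0 < RA) (hRB : 0 ≤ MB - cB * pB) (hp : pB ≤ pA) :
    responsePayoffB RA MB cB pA pB = chaserValue (pA - pB) RA (MB - cB * pB) := by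
  rw [responsePayoffB, (hasLottoValue_headStart (sub_nonneg.2 hp) hRA hRB).eqPayoffA_eq,
    sub_sub_cancel]

theorem responsePayoffB_of_ge (hRA : 0 < RA) (hRB : 0 ≤ MB - cB * pB) (hp : pA ≤ pB) :
    responsePayoffB RA MB cB pA pB = 1 - chaserValue (pB - pA) (MB - cB * pB) RA := by
  rw [responsePayoffB, ← neg_sub pB,
    (hasLottoValue_neg_headStart (sub_nonneg.2 hp) hRB hRA).eqPayoffA_eq]

theorem responsePayoffB_eq_uB1A (hRA : 0 < RA) (hRB : 0 ≤ MB - cB * pB) (hp : pB ≤ pA)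
    (h : MB - cB * pB ≤ pA - pB + headRoot (pA - pB) RA / 2) :
    responsePayoffB RA MB cB pA pB = uB1A RA MB cB pA pB := by
  have hp' : 0 ≤ pA - pB := sub_nonneg.2 hp
  have hroot := headRoot_pos hp' hRA
  have hf : fA RA pA pB = headRoot (pA - pB) RA := rfl
  rw [responsePayoffB_of_le hRA hRB hp, chaserValue_of_le hp' hRA.le (by linarith) h, uB1A, hf,
    div_pow, headRoot_sq hp' hRA.le, add_comm (pA - pB)]
  field_simp

theorem responsePayoffB_eq_uB2A (hRA : 0 < RA) (hp : pB ≤ pA)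
    (h : pA - pB + headRoot (pA - pB) RA / 2 ≤ MB - cB * pB) :
    responsePayoffB RA MB cB pA pB = uB2A RA MB cB pA pB := by
  have hp' : 0 ≤ pA - pB := sub_nonneg.2 hp
  have hRB : 0 < MB - cB * pB := by linarith [headRoot_pos hp' hRA]
  rw [responsePayoffB_of_le hRA hRB.le hp, chaserValue_of_ge hRB h, uB2A]

theorem fB_mul_fB_add_gB (hRB : 0 ≤ MB - cB * pB) :
    fB MB cB pB * (fB MB cB pB + gB MB cB pA pB) = headRoot (pB - pA) (MB - cB * pB) := by
  rw [headRoot, fB, gB, mul_add, Real.mul_self_sqrt hRB, Real.sqrt_mul hRB]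

theorem fB_add_gB_sq (hRB : 0 ≤ MB - cB * pB) (hp : pA ≤ pB) :
    (fB MB cB pB + gB MB cB pA pB) ^ 2 =
      2 * (pB - pA + headRoot (pB - pA) (MB - cB * pB)) := by
  have hf : fB MB cB pB ^ 2 = MB - cB * pB := Real.sq_sqrt hRB
  have hg : gB MB cB pA pB ^ 2 = MB - cB * pB + 2 * (pB - pA) := Real.sq_sqrt (by linarith)
  rw [← fB_mul_fB_add_gB hRB]
  linear_combination hg - hf

theorem responsePayoffB_eq_uB1B (hRA : 0 < RA) (hRB : 0 ≤ MB - cB * pB) (hp : pA ≤ pB)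
    (h : RA ≤ pB - pA + headRoot (pB - pA) (MB - cB * pB) / 2) :
    responsePayoffB RA MB cB pA pB = uB1B RA MB cB pA pB := by
  have hp' : 0 ≤ pB - pA := sub_nonneg.2 hp
  have hpos : 0 < pB - pA + headRoot (pB - pA) (MB - cB * pB) := by
    linarith [two_mul_le_headRoot hp' hRB]
  rw [responsePayoffB_of_ge hRA hRB hp, chaserValue_of_le hp' hRB hpos h, uB1B, div_pow,
    fB_mul_fB_add_gB hRB, fB_add_gB_sq hRB hp]
  field_simp

theorem responsePayoffB_eq_uB1B_of_le_add (hRA : 0 < RA) (hRB : 0 ≤ MB - cB * pB)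
    (hp : pA ≤ pB) (h : RA ≤ MB - cB * pB + (pB - pA)) :
    responsePayoffB RA MB cB pA pB = uB1B RA MB cB pA pB :=
  responsePayoffB_eq_uB1B hRA hRB hp
    (by linarith [two_mul_le_headRoot (sub_nonneg.2 hp) hRB])

theorem responsePayoffB_eq_uB2B (hRA : 0 < RA) (hRB : 0 ≤ MB - cB * pB) (hp : pA ≤ pB)
    (h : pB - pA + headRoot (pB - pA) (MB - cB * pB) / 2 ≤ RA) :
    responsePayoffB RA MB cB pA pB = uB2B RA MB cB pA pB := by
  rw [responsePayoffB_of_ge hRA hRB hp, chaserValue_of_ge hRA h, uB2B, sub_sub_cancel]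

end Response

section Monotone

variable {RA MB cB pA : ℝ}

theorem sub_mul_nonneg_of_le_div {x : ℝ} (hcB : 0 < cB) (hx : x ≤ MB / cB) :
    0 ≤ MB - cB * x :=
  sub_nonneg.2 ((le_div_iff₀' hcB).1 hx)

theorem responsePayoffB_strictAntiOn_left (hRA : 0 < RA) (hc0 : 0 < cB) (hc1 : cB ≤ 1)
    (hMB : MB ≤ cB * (RA + pA)) :
    StrictAntiOn (responsePayoffB RA MB cB pA) (Iic pA ∩ Iic (MB / cB)) := by
  intro x hx y hy hxy
  have hbudget : ∀ z, MB - cB * z = MB - cB * pA + cB * (pA - z) := fun z => by ring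
  rw [responsePayoffB_of_le hRA (sub_mul_nonneg_of_le_div hc0 hx.2) hx.1,
    responsePayoffB_of_le hRA (sub_mul_nonneg_of_le_div hc0 hy.2) hy.1, hbudget x, hbudget y]
  exact chaserValue_add_mul_strictMonoOn hRA hc0 hc1 (by linarith)
    (mem_Ici.2 (sub_nonneg.2 hy.1)) (mem_Ici.2 (sub_nonneg.2 hx.1)) (sub_lt_sub_left hxy pA)

theorem responsePayoffB_eq_one_sub_shift (hRA : 0 < RA) {y : ℝ} (hRB : 0 ≤ MB - cB * y)
    (hp : pA ≤ y) (x : ℝ) : responsePayoffB RA MB cB pA y =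
      1 - chaserValue (x - pA + (y - x)) (MB - cB * x - cB * (y - x)) RA := by
  rw [responsePayoffB_of_ge hRA hRB hp]
  congr 2 <;> ring

theorem responsePayoffB_antitoneOn_right (hRA : 0 < RA) (hc0 : 0 < cB)
    (hMB : MB ≤ cB * (RA + pA)) :
    AntitoneOn (responsePayoffB RA MB cB pA) (Icc pA (MB / cB)) := by
  intro x hx y hy hxy
  rcases hxy.eq_or_lt with rfl | hlt
  · rfl
  have hRB := sub_mul_nonneg_of_le_div hc0 hy.2
  rw [responsePayoffB_of_ge hRA (sub_mul_nonneg_of_le_div hc0 hx.2) hx.1,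
    responsePayoffB_eq_one_sub_shift hRA hRB hy.1 x]
  exact sub_le_sub_left (chaserValue_le_shift (sub_nonneg.2 hx.1) hRA hc0 (sub_pos.2 hlt)
    (by linarith) (by linarith)) 1

theorem responsePayoffB_strictAntiOn_right (hRA : 0 < RA) (hc0 : 0 < cB)
    (hMB : MB < cB * (RA + pA)) :
    StrictAntiOn (responsePayoffB RA MB cB pA) (Icc pA (MB / cB)) := by
  intro x hx y hy hlt
  have hRB := sub_mul_nonneg_of_le_div hc0 hy.2
  rw [responsePayoffB_of_ge hRA (sub_mul_nonneg_of_le_div hc0 hx.2) hx.1,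
    responsePayoffB_eq_one_sub_shift hRA hRB hy.1 x]
  exact sub_lt_sub_left (chaserValue_lt_shift (sub_nonneg.2 hx.1) hRA hc0 (sub_pos.2 hlt)
    (by linarith) (by linarith)) 1

theorem responsePayoffB_antitoneOn (hRA : 0 < RA) (hc0 : 0 < cB) (hc1 : cB ≤ 1)
    (hMB : MB ≤ cB * (RA + pA)) :
    AntitoneOn (responsePayoffB RA MB cB pA) (Iic (MB / cB)) := by
  have hleft := (responsePayoffB_strictAntiOn_left hRA hc0 hc1 hMB).antitoneOn
  rcases le_total (MB / cB) pA with hm | hm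
  · rwa [inter_eq_right.2 (Iic_subset_Iic.2 hm)] at hleft
  · rw [inter_eq_left.2 (Iic_subset_Iic.2 hm)] at hleft
    rw [← Iic_union_Icc_eq_Iic hm]
    exact hleft.union_right (responsePayoffB_antitoneOn_right hRA hc0 hMB) isGreatest_Iic
      (isLeast_Icc hm)

theorem responsePayoffB_strictAntiOn (hRA : 0 < RA) (hc0 : 0 < cB) (hc1 : cB ≤ 1)
    (hMB : MB < cB * (RA + pA)) :
    StrictAntiOn (responsePayoffB RA MB cB pA) (Iic (MB / cB)) := by
  have hleft := responsePayoffB_strictAntiOn_left hRA hc0 hc1 hMB.le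
  rcases le_total (MB / cB) pA with hm | hm
  · rwa [inter_eq_right.2 (Iic_subset_Iic.2 hm)] at hleft
  · rw [inter_eq_left.2 (Iic_subset_Iic.2 hm)] at hleft
    rw [← Iic_union_Icc_eq_Iic hm]
    exact hleft.union (responsePayoffB_strictAntiOn_right hRA hc0 hMB) isGreatest_Iic
      (isLeast_Icc hm)

end Monotone

section BreakF

variable {RA MB cB pA pB R : ℝ}

theorem le_breakF_iff (hRA : 0 < RA) (hR : 0 ≤ R) (hpB : pB ∈ Ico pA (RA + pA)) :
    R ≤ breakF RA pA pB ↔ pB - pA + headRoot (pB - pA) R / 2 ≤ RA := by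
  have hroot := headRoot_le_iff (t := 2 * (RA - (pB - pA))) (sub_nonneg.2 hpB.1) hR
    (by linarith [hpB.2])
  have hden : 0 < 2 * RA + pA - pB := by linarith [hpB.2]
  rw [breakF, le_div_iff₀ hden]
  constructor
  · intro h
    linarith [hroot.2 (by linarith)]
  · intro h
    linarith [hroot.1 (by linarith)]

theorem breakF_le_iff (hRA : 0 < RA) (hR : 0 ≤ R) (hpB : pB ∈ Ico pA (RA + pA)) :
    breakF RA pA pB ≤ R ↔ RA ≤ pB - pA + headRoot (pB - pA) R / 2 := by
  have hroot := le_headRoot_iff (t := 2 * (RA - (pB - pA))) (sub_nonneg.2 hpB.1) hR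
    (by linarith [hpB.2])
  have hden : 0 < 2 * RA + pA - pB := by linarith [hpB.2]
  rw [breakF, div_le_iff₀ hden]
  constructor
  · intro h
    linarith [hroot.2 (by linarith)]
  · intro h
    linarith [hroot.1 (by linarith)]

theorem breakF_pos (hRA : 0 < RA) (hpB : pB < RA + pA) : 0 < breakF RA pA pB := by
  have hden : 0 < 2 * RA + pA - pB := by linarith
  rw [breakF]
  positivity

-- Both the budget and `breakF` decrease, so their difference need not be monotone.
theorem budget_div_breakF_strictMonoOn (hRA : 0 < RA) (hc : 0 ≤ cB)
    (hMB : cB * (RA + pA) < MB) :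
    StrictMonoOn (fun pB => (MB - cB * pB) / breakF RA pA pB) (Iio (RA + pA)) := by
  have hfactor : ∀ x ∈ Iio (RA + pA), (MB - cB * x) / breakF RA pA x =
      ((MB - cB * (RA + pA)) / (RA + pA - x) + cB) * (RA / (RA + pA - x) + 1) / 2 := by
    intro x hx
    have hs : RA + pA - x ≠ 0 := (sub_pos.2 hx).ne'
    rw [breakF]
    field_simp
    ring
  intro x hx y hy hxy
  have hs : 0 < RA + pA - y := sub_pos.2 hy
  have hs' : 0 < RA + pA - x := sub_pos.2 hx
  simp only [hfactor x hx, hfactor y hy]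
  gcongr

theorem existsUniqueSol_breakF (hRA : 0 < RA) (hc : 0 ≤ cB) (hlow : cB * (RA + pA) < MB)
    (hhigh : MB ≤ RA + cB * pA) :
    ∃ q, IsUniqueSolOn (Ico pA (RA + pA)) (fun pB => breakF RA pA pB = MB - cB * pB) q := by
  have hcont : ContinuousOn (fun x => breakF RA pA x - (MB - cB * x)) (Icc pA (RA + pA)) := by
    refine ContinuousOn.sub (ContinuousOn.div (by fun_prop) (by fun_prop) fun x hx => ?_)
      (by fun_prop)
    linarith [hx.2]
  have hstart : breakF RA pA pA = RA := by
    rw [breakF]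
    field_simp
    ring
  have hend : breakF RA pA (RA + pA) = 0 := by simp [breakF]
  obtain ⟨q, hq, hroot⟩ := intermediate_value_Ico' (by linarith) hcont
    (show (0 : ℝ) ∈ Ioc _ _ by constructor <;> simp only [hstart, hend] <;> linarith)
  refine ⟨q, hq, sub_eq_zero.1 hroot, fun q' hq' hsol => ?_⟩
  refine (budget_div_breakF_strictMonoOn hRA hc hlow).injOn hq'.2 hq.2 ?_
  simp only [← hsol, ← sub_eq_zero.1 hroot, div_self (breakF_pos hRA hq'.2).ne',
    div_self (breakF_pos hRA hq.2).ne']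

theorem budget_le_breakF_of_le {q : ℝ} (hRA : 0 < RA) (hc : 0 ≤ cB)
    (hlow : cB * (RA + pA) < MB) (hq : q < RA + pA) (hsol : breakF RA pA q = MB - cB * q)
    (hle : pB ≤ q) : MB - cB * pB ≤ breakF RA pA pB := by
  have hmono := (budget_div_breakF_strictMonoOn hRA hc hlow).monotoneOn
    (mem_Iio.2 (hle.trans_lt hq)) hq hle
  simp only [← hsol, div_self (breakF_pos hRA hq).ne'] at hmono
  exact (div_le_one (breakF_pos hRA (hle.trans_lt hq))).1 hmono

theorem breakF_le_budget_of_le {q : ℝ} (hRA : 0 < RA) (hc : 0 ≤ cB)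
    (hlow : cB * (RA + pA) < MB) (hpB : pB < RA + pA) (hsol : breakF RA pA q = MB - cB * q)
    (hle : q ≤ pB) : breakF RA pA pB ≤ MB - cB * pB := by
  have hq : q < RA + pA := hle.trans_lt hpB
  have hmono := (budget_div_breakF_strictMonoOn hRA hc hlow).monotoneOn hq hpB hle
  simp only [← hsol, div_self (breakF_pos hRA hq).ne'] at hmono
  exact (one_le_div (breakF_pos hRA hpB)).1 hmono

theorem exists_breakF_sol_responsePayoffB_eq (hRA : 0 < RA) (hc0 : 0 < cB) (hc1 : cB ≤ 1)
    (hlow : cB * (RA + pA) < MB) (hhigh : MB ≤ RA + cB * pA) :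
    ∃ p1B, IsUniqueSolOn (Ico pA (RA + pA)) (fun pB => breakF RA pA pB = MB - cB * pB) p1B ∧
      (∀ pB ∈ Iic pA, responsePayoffB RA MB cB pA pB = uB1A RA MB cB pA pB) ∧
      (∀ pB ∈ Ioc pA p1B, responsePayoffB RA MB cB pA pB = uB2B RA MB cB pA pB) ∧
      (∀ pB ∈ Ioc p1B (MB / cB), responsePayoffB RA MB cB pA pB = uB1B RA MB cB pA pB) := by
  have hbudget : ∀ x ≤ RA + pA, 0 ≤ MB - cB * x := fun x hx => by
    linarith [mul_le_mul_of_nonneg_left hx hc0.le]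
  obtain ⟨q, hq, hsol, hunique⟩ := existsUniqueSol_breakF hRA hc0.le hlow hhigh
  refine ⟨q, ⟨hq, hsol, hunique⟩, fun x hx => ?_, fun x hx => ?_, fun x hx => ?_⟩
  · have hx : x ≤ pA := hx
    refine responsePayoffB_eq_uB1A hRA (hbudget x (by linarith)) hx ?_
    nlinarith [two_mul_le_headRoot (sub_nonneg.2 hx) hRA.le]
  · have hRB := hbudget x (hx.2.trans hq.2.le)
    exact responsePayoffB_eq_uB2B hRA hRB hx.1.le <|
      (le_breakF_iff hRA hRB ⟨hx.1.le, hx.2.trans_lt hq.2⟩).1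
        (budget_le_breakF_of_le hRA hc0.le hlow hq.2 hsol hx.2)
  · have hpA : pA ≤ x := hq.1.trans hx.1.le
    have hRB := sub_mul_nonneg_of_le_div hc0 hx.2
    rcases lt_or_ge x (RA + pA) with hlt | hge
    · exact responsePayoffB_eq_uB1B hRA hRB hpA <|
        (breakF_le_iff hRA hRB ⟨hpA, hlt⟩).1
          (breakF_le_budget_of_le hRA hc0.le hlow hlt hsol hx.1.le)
    · exact responsePayoffB_eq_uB1B_of_le_add hRA hRB hpA (by linarith)

end BreakF

section BreakG

variable {RA MB cB pA pB : ℝ}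

theorem budget_excess_strictMonoOn (hRA : 0 < RA) (hc1 : cB ≤ 1) :
    StrictMonoOn (fun x => MB - cB * x - (pA - x + headRoot (pA - x) RA / 2)) (Iic pA) := by
  intro x hx y hy hxy
  have hroot : headRoot (pA - y) RA < headRoot (pA - x) RA :=
    headRoot_strictMonoOn_left hRA (mem_Ici.2 (sub_nonneg.2 hy)) (mem_Ici.2 (sub_nonneg.2 hx))
      (sub_lt_sub_left hxy pA)
  have hgain : 0 ≤ (1 - cB) * (y - x) := mul_nonneg (sub_nonneg.2 hc1) (sub_pos.2 hxy).le
  dsimp only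
  linarith

theorem breakG_eq_iff (hRA : 0 < RA) (hpB : pB < pA) (hle : pA - pB ≤ MB - cB * pB) :
    breakG MB cB pA pB = RA ↔ MB - cB * pB = pA - pB + headRoot (pA - pB) RA / 2 := by
  have hp : 0 < pA - pB := sub_pos.2 hpB
  have hroot : 2 * RA < headRoot (pA - pB) RA := by
    simpa only [headRoot_zero_left hRA.le] using
      headRoot_strictMonoOn_left hRA self_mem_Ici hp.le hp
  have hfactor := sq_sub_eq_mul_headRoot hp.le hRA.le (2 * (MB - cB * pB - (pA - pB)))
  have hden : 2 * (MB - cB * pB) - (pA - pB) ≠ 0 := by linarith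
  rw [breakG, div_eq_iff hden]
  constructor
  · intro h
    have hzero : (2 * (MB - cB * pB - (pA - pB)) - headRoot (pA - pB) RA) *
        (2 * (MB - cB * pB - (pA - pB)) + (headRoot (pA - pB) RA - 2 * RA)) = 0 := by
      linarith
    rcases mul_eq_zero.1 hzero with h | h <;> linarith
  · intro h
    have hzero : 2 * (MB - cB * pB - (pA - pB)) - headRoot (pA - pB) RA = 0 := by linarith
    rw [hzero, zero_mul] at hfactor
    linarith

theorem exists_budget_excess_eq_zero (hRA : 0 < RA) (hpA : 0 ≤ pA) (hlow : RA + cB * pA < MB)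
    (hhigh : MB ≤ pA + headRoot pA RA / 2) :
    ∃ q ∈ Ico 0 pA, MB - cB * q - (pA - q + headRoot (pA - q) RA / 2) = 0 := by
  have hcont : Continuous fun x => MB - cB * x - (pA - x + headRoot (pA - x) RA / 2) := by
    unfold headRoot
    fun_prop
  refine intermediate_value_Ico hpA hcont.continuousOn ⟨?_, ?_⟩
  · simpa using hhigh
  · simp only [sub_self, headRoot_zero_left hRA.le]
    linarith

theorem responsePayoffB_eq_uB1B_of_add_mul_le (hRA : 0 < RA) (hc0 : 0 < cB) (hc1 : cB ≤ 1)
    (hMB : RA + cB * pA ≤ MB) (hpB : pB ∈ Ioc pA (MB / cB)) :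
    responsePayoffB RA MB cB pA pB = uB1B RA MB cB pA pB :=
  responsePayoffB_eq_uB1B_of_le_add hRA (sub_mul_nonneg_of_le_div hc0 hpB.2) hpB.1.le
    (by linarith [mul_nonneg (sub_nonneg.2 hc1) (sub_pos.2 hpB.1).le])

theorem exists_breakG_sol_responsePayoffB_eq (hRA : 0 < RA) (hpA : 0 ≤ pA) (hc0 : 0 < cB)
    (hc1 : cB ≤ 1) (hlow : RA + cB * pA < MB) (hhigh : MB ≤ pA + headRoot pA RA / 2) :
    ∃ p1A, IsUniqueSolOn {pB | pB ∈ Ico 0 pA ∧ pA - pB ≤ MB - cB * pB}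
        (fun pB => breakG MB cB pA pB = RA) p1A ∧
      (∀ pB ∈ Icc 0 p1A, responsePayoffB RA MB cB pA pB = uB1A RA MB cB pA pB) ∧
      (∀ pB ∈ Ioc p1A pA, responsePayoffB RA MB cB pA pB = uB2A RA MB cB pA pB) ∧
      (∀ pB ∈ Ioc pA (MB / cB), responsePayoffB RA MB cB pA pB = uB1B RA MB cB pA pB) := by
  have hmono := budget_excess_strictMonoOn (MB := MB) (pA := pA) hRA hc1
  obtain ⟨q, hq, hzero⟩ := exists_budget_excess_eq_zero hRA hpA hlow hhigh
  have hqle : pA - q ≤ MB - cB * q := by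
    linarith [headRoot_pos (sub_nonneg.2 hq.2.le) hRA]
  refine ⟨q, ⟨⟨hq, hqle⟩, (breakG_eq_iff hRA hq.2 hqle).2 (sub_eq_zero.1 hzero), ?_⟩,
    fun x hx => ?_, fun x hx => ?_,
    fun x hx => responsePayoffB_eq_uB1B_of_add_mul_le hRA hc0 hc1 hlow.le hx⟩
  · rintro x ⟨hx, hxle⟩ hsol
    exact hmono.injOn hx.2.le hq.2.le <|
      (sub_eq_zero.2 ((breakG_eq_iff hRA hx.2 hxle).1 hsol)).trans hzero.symm
  · have hxA : x ≤ pA := hx.2.trans hq.2.le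
    have hRB : 0 ≤ MB - cB * x := by linarith [mul_le_mul_of_nonneg_left hxA hc0.le]
    exact responsePayoffB_eq_uB1A hRA hRB hxA <|
      sub_nonpos.1 ((hmono.monotoneOn hxA hq.2.le hx.2).trans_eq hzero)
  · exact responsePayoffB_eq_uB2A hRA hx.2 <|
      sub_nonneg.1 (hzero.symm.trans_le (hmono.monotoneOn hq.2.le hx.2 hx.1.le))

theorem responsePayoffB_eq_of_add_headRoot_lt (hRA : 0 < RA) (hpA : 0 ≤ pA) (hc0 : 0 < cB)
    (hc1 : cB ≤ 1) (hMB : pA + headRoot pA RA / 2 < MB) :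
    (∀ pB ∈ Icc 0 pA, responsePayoffB RA MB cB pA pB = uB2A RA MB cB pA pB) ∧
      (∀ pB ∈ Ioc pA (MB / cB), responsePayoffB RA MB cB pA pB = uB1B RA MB cB pA pB) := by
  have hexcess : ∀ x ∈ Icc 0 pA, 0 ≤ MB - cB * x - (pA - x + headRoot (pA - x) RA / 2) :=
    fun x hx => by
      have hmono := (budget_excess_strictMonoOn (MB := MB) hRA hc1).monotoneOn
        (mem_Iic.2 hpA) hx.2 hx.1
      refine le_trans ?_ hmono
      simpa using hMB.le
  refine ⟨fun x hx => responsePayoffB_eq_uB2A hRA hx.2 (sub_nonneg.1 (hexcess x hx)),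
    fun x hx => responsePayoffB_eq_uB1B_of_add_mul_le hRA hc0 hc1 ?_ hx⟩
  have hend := hexcess pA (right_mem_Icc.2 hpA)
  rw [sub_self, headRoot_zero_left hRA.le] at hend
  linarith

end BreakG

theorem mainTheorem7 (MA cA MB cB pA RA : ℝ)
    (hcA : cA ∈ Ioo (0 : ℝ) 1) (hcB : cB ∈ Ioo (0 : ℝ) 1) (hMB : 0 ≤ MB)
    (hpA : pA ∈ Icc 0 (MA / cA)) (hRA : RA = MA - cA * pA) (hRA_pos : 0 < RA) :
    -- the equilibrium payoff of the final stage is well defined for every response of `B`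
    (∀ pB ∈ Icc 0 (MB / cB), ∃ v, lottoNashPayoffsA (pA - pB) RA (MB - cB * pB) = {v}) ∧
    -- a)
    (MB / cB ≤ RA + pA →
      AntitoneOn (fun pB => stackPayoffB MA cA MB cB pA pB) (Icc 0 (MB / cB))) ∧
    (MB / cB < RA + pA →
      StrictAntiOn (fun pB => stackPayoffB MA cA MB cB pA pB) (Icc 0 (MB / cB))) ∧
    -- b)
    (RA + pA < MB / cB → MB / cB ≤ RA / cB + pA →
      ∃ p1B, IsUniqueSolOn (Ico pA (RA + pA)) (fun pB => breakF RA pA pB = MB - cB * pB) p1B ∧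
        (∀ pB ∈ Icc 0 pA, stackPayoffB MA cA MB cB pA pB = uB1A RA MB cB pA pB) ∧
        (∀ pB ∈ Ioc pA p1B, stackPayoffB MA cA MB cB pA pB = uB2B RA MB cB pA pB) ∧
        (∀ pB ∈ Ioc p1B (MB / cB), stackPayoffB MA cA MB cB pA pB = uB1B RA MB cB pA pB)) ∧
    -- c)
    (RA / cB + pA < MB / cB →
      MB / cB ≤ 1 / cB * (pA + (RA + √(RA * (RA + 2 * pA))) / 2) →
      ∃ p1A, IsUniqueSolOn {pB | pB ∈ Ico 0 pA ∧ pA - pB ≤ MB - cB * pB}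
          (fun pB => breakG MB cB pA pB = RA) p1A ∧
        (∀ pB ∈ Icc 0 p1A, stackPayoffB MA cA MB cB pA pB = uB1A RA MB cB pA pB) ∧
        (∀ pB ∈ Ioc p1A pA, stackPayoffB MA cA MB cB pA pB = uB2A RA MB cB pA pB) ∧
        (∀ pB ∈ Ioc pA (MB / cB), stackPayoffB MA cA MB cB pA pB = uB1B RA MB cB pA pB)) ∧
    -- d)
    (1 / cB * (pA + (RA + √(RA * (RA + 2 * pA))) / 2) < MB / cB →
        (∀ pB ∈ Icc 0 pA, stackPayoffB MA cA MB cB pA pB = uB2A RA MB cB pA pB) ∧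
        (∀ pB ∈ Ioc pA (MB / cB),
          stackPayoffB MA cA MB cB pA pB = uB1B RA MB cB pA pB)) := by
  obtain ⟨hc0, hc1⟩ : 0 < cB ∧ cB ≤ 1 := ⟨hcB.1, hcB.2.le⟩
  have hpayoff : ∀ pB, stackPayoffB MA cA MB cB pA pB = responsePayoffB RA MB cB pA pB :=
    fun _ => hRA ▸ rfl
  have hmid : RA / cB + pA = (RA + cB * pA) / cB := by field_simp
  have htop : 1 / cB * (pA + (RA + √(RA * (RA + 2 * pA))) / 2) =
      (pA + headRoot pA RA / 2) / cB := one_div_mul_eq_div _ _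
  simp only [hpayoff]
  rw [hmid, htop, div_le_iff₀' hc0, div_lt_iff₀' hc0, lt_div_iff₀' hc0,
    div_le_div_iff_of_pos_right hc0, div_lt_div_iff_of_pos_right hc0,
    div_le_div_iff_of_pos_right hc0, div_lt_div_iff_of_pos_right hc0]
  refine ⟨fun pB hpB => ?_,
    fun hMB => (responsePayoffB_antitoneOn hRA_pos hc0 hc1 hMB).mono Icc_subset_Iic_self,
    fun hMB => (responsePayoffB_strictAntiOn hRA_pos hc0 hc1 hMB).mono Icc_subset_Iic_self,
    fun hlow hhigh => ?_,
    exists_breakG_sol_responsePayoffB_eq hRA_pos hpA.1 hc0 hc1,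
    responsePayoffB_eq_of_add_headRoot_lt hRA_pos hpA.1 hc0 hc1⟩
  · obtain ⟨v, hv⟩ := exists_hasLottoValue (pA - pB) hRA_pos (sub_mul_nonneg_of_le_div hc0 hpB.2)
    exact ⟨v, hv.nashPayoffsA_eq⟩
  · obtain ⟨q, hq, hleft, hright⟩ :=
      exists_breakF_sol_responsePayoffB_eq hRA_pos hc0 hc1 hlow hhigh
    exact ⟨q, hq, fun pB hpB => hleft pB hpB.2, hright⟩
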